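/- A permutation is an ordering of a finite set of positive integers, written in one-line notation, and $S_n$ is the set of permutations of $\{1,\ldots,n\}$. The stack-sorting map $s$ sends the empty permutation to itself, and if $\pi = LmR$ is a nonempty permutation with largest entry $m$, then $s(\pi)=s(L)\,s(R)\,m$. For a set $A$ of permutations, $s^{-1}(A)$ is the set of all permutations $\pi$ with $s(\pi)\in A$. Let $\operatorname{Av}_{n,k}(231,312,321)$ be the set of permutations $\pi=\pi_1\cdots\pi_n\in S_n$ that avoid the patterns $231$, $312$ and $321$ and have exactly $k$ descents (indices $i$ with $\pi_i>\pi_{i+1}$). Let $\operatorname{Comp}_a(b)$ be the set of $a$-tuples of positive integers with sum $b$. For $q=(q_1,\ldots,q_a)\in\operatorname{Comp}_a(b)$ put $C_q=\prod_{t=1}^a C_{q_t}$, where $C_j=\frac1{j+1}\binom{2j}{j}$, and let $D_q$ be the number of $y\in\operatorname{Comp}_a(b)$ such that $\sum_{i=1}^{\ell} y_i\le\sum_{i=1}^{\ell} q_i$ for all $\ell\in\{1,\ldots,a\}$. Binomial coefficients $\binom{c}{d}$ are $0$ unless $0\le d\le c$. **Theorem.** For all integers $n\ge 1$ and $k\ge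 0$, the set $s^{-1}(\operatorname{Av}_{n,k}(231,312,321))$ is finite, and $$\bigl|s^{-1}(\operatorname{Av}_{n,k}(231,312,321))\bigr|=\frac{1}{n+1}\binom{n-k-1}{k}\binom{2n-2k}{n}.$$ Moreover, $$\sum_{q\in\operatorname{Comp}_{k+1}(n-k)}C_qD_q=\frac{1}{n+1}\binom{n-k-1}{k}\binom{2n-2k}{n}.$$ -/

import Mathlib

/-- A permutation: an ordering of a finite set of positive integers, in one-line notation. -/
def IsPermutation (π : List ℕ) : Prop :=
  π.Nodup ∧ ∀ x ∈ π, 0 < x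

/-- `S n` is the set of permutations of `[n] = {1, …, n}`. -/
def S (n : ℕ) : Set (List ℕ) :=
  {π | IsPermutation π ∧ π.toFinset = Finset.Icc 1 n}

/-- The normalization of a permutation: the `i`-th smallest entry is replaced with `i`
(an entry `x` is the `i`-th smallest when exactly `i` entries are at most `x`). -/
def normalization (π : List ℕ) : List ℕ :=
  π.map fun x => π.countP (fun y => decide (y ≤ x))

/-- `σ` contains the pattern `τ`: some subsequence `σ_{i₁} ⋯ σ_{iₘ}` with `i₁ < ⋯ < iₘ`
has normalization `τ`. (In Mathlib, `ρ.Sublist σ` says that `ρ` is a subsequence of `σ`.) -/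
def ContainsPattern (σ τ : List ℕ) : Prop :=
  ∃ ρ : List ℕ, ρ.Sublist σ ∧ normalization ρ = τ

/-- `Av n P`: the permutations in `S n` that avoid every pattern in `P`. -/
def Av (n : ℕ) (P : Set (List ℕ)) : Set (List ℕ) :=
  {π | π ∈ S n ∧ ∀ τ ∈ P, ¬ ContainsPattern π τ}

/-- The number of descents, i.e. of indices `i` with `π_i > π_{i+1}`. -/
def des (π : List ℕ) : ℕ :=
  (π.zip π.tail).countP fun p => decide (p.2 < p.1)

/-- `AvDes n k P`: the permutations in `Av n P` with exactly `k` descents. -/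
def AvDes (n k : ℕ) (P : Set (List ℕ)) : Set (List ℕ) :=
  {π | π ∈ Av n P ∧ des π = k}

/-- The part of `π` to the left of the first occurrence of `m`. -/
def leftOf (m : ℕ) (π : List ℕ) : List ℕ := π.take (π.idxOf m)

/-- The part of `π` to the right of the first occurrence of `m`. -/
def rightOf (m : ℕ) (π : List ℕ) : List ℕ := π.drop (π.idxOf m + 1)

theorem length_leftOf_lt {m : ℕ} {π : List ℕ} (h : m ∈ π) :
    (leftOf m π).length < π.length := by
  have := List.idxOf_lt_length_of_mem h
  simp only [leftOf, List.length_take]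
  omega

theorem length_rightOf_lt {m : ℕ} {π : List ℕ} (h : m ∈ π) :
    (rightOf m π).length < π.length := by
  have := List.idxOf_lt_length_of_mem h
  simp only [rightOf, List.length_drop]
  omega

/-- West's stack-sorting map: the empty permutation goes to itself, and
`s(L m R) = s(L) s(R) m`, where `m` is the largest entry. -/
def stackSort (π : List ℕ) : List ℕ :=
  if h : π = [] then []
  else
    stackSort (leftOf (π.max h) π) ++ stackSort (rightOf (π.max h) π) ++ [π.max h]
termination_by π.length
decreasing_by
  · exact length_leftOf_lt (List.max_mem h)
  · exact length_rightOf_lt (List.max_mem h)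

/-- `s⁻¹(A)`: all permutations that the stack-sorting map sends into `A`. -/
def stackSortPreimage (A : Set (List ℕ)) : Set (List ℕ) :=
  {π | IsPermutation π ∧ stackSort π ∈ A}

/-- `Comp a b`: the compositions of `b` into `a` (positive) parts. -/
def Comp (a b : ℕ) : Finset (Composition b) :=
  Finset.univ.filter fun x => x.length = a

/-- `x ≼ y`: for every `ℓ`, the first `ℓ` parts of `x` have sum at most that of the first `ℓ`
parts of `y`. Used for compositions with the same number of parts. -/
def CompLE {b : ℕ} (x y : Composition b) : Prop :=
  ∀ l ∈ Finset.Icc 1 y.length, x.sizeUpTo l ≤ y.sizeUpTo l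

open Classical in
/-- `D_x`: the number of compositions `y ≼ x` with as many parts as `x`. -/
noncomputable def compD {b : ℕ} (x : Composition b) : ℕ :=
  ((Comp x.length b).filter fun y => CompLE y x).card

/-- `C_x`: the product of the Catalan numbers of the parts of `x`. -/
def compC {b : ℕ} (x : Composition b) : ℕ :=
  (x.blocks.map catalan).prod

/-! Both quantities are the coefficient of `x^(n-k) s^k` in one power series `P`, the solution of `P
= x (1 + sP)(1 + P)^2`; Lagrange inversion evaluates that coefficient. Permutations avoiding 231,
312 and 321 are direct sums of layers 1 and 21 (`AvDes_eq_image`). They are coded by words with one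
letter per layer, so size `n` with `k` descents means `n - k` letters, `k` of them `true`. A
preimage of `τm` is `LmR` with `s(L) s(R) = τ`, so preimages are counted by summing over the cuts of
`τ`. A cut falls between layers or splits a layer 21 into two singletons, so the count depends on
the word alone (`IsLayered.ncard_stackSortPreimage`). Summing over words turns this recursion into
the equation for `P`, where `1 + P` is the generating function (`fertilitySeries_sub_one`). For
compositions, put `U = 1 + sP`. The equation reads `1 + P = 1 + xU (1 + P)^2`, so `P` is the sum of
`C_j (xU)^j` over `j ≥ 1`. Hence `U^(h+1) = U^h + s ∑ C_j x^j U^(h+j)`, which is the recursion for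
the sums of `C_q D_q` on removing the first part, with `h` recording the slack between partial sums
(`sum_dominatedSum_eq_coeff`). -/

/-! ### Lagrange inversion for a polynomial `φ`. -/

section Lagrange

open PowerSeries

/-- The functional `f ↦ ∑ₙ [vⁿ](f φⁿ⁻¹ (φ - v φ')) xⁿ`, which computes `f(P)` for the solution `P`
of `P = x φ(P)`. -/
noncomputable def lagrangeFunctional {R : Type*} [CommRing R] (φ f : Polynomial R) : R⟦X⟧ :=
  PowerSeries.mk fun n => match n with
    | 0 => f.coeff 0
    | n + 1 => (f * φ ^ n * (φ - Polynomial.X * φ.derivative)).coeff (n + 1)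

theorem lagrangeFunctional_add {R : Type*} [CommRing R] (φ f g : Polynomial R) :
    lagrangeFunctional φ (f + g) = lagrangeFunctional φ f + lagrangeFunctional φ g := by
  ext n
  cases n <;> simp [lagrangeFunctional, add_mul]

theorem lagrangeFunctional_C_mul {R : Type*} [CommRing R] (φ f : Polynomial R) (r : R) :
    lagrangeFunctional φ (Polynomial.C r * f) = PowerSeries.C r * lagrangeFunctional φ f := by
  ext n
  cases n <;> simp [lagrangeFunctional, mul_assoc]

theorem lagrangeFunctional_X_mul {R : Type*} [CommRing R] (φ f : Polynomial R) :
    lagrangeFunctional φ (Polynomial.X * f) = PowerSeries.X * lagrangeFunctional φ (φ * f) := by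
  ext n
  rcases n with _ | _ | n
  · simp [lagrangeFunctional]
  -- Index 0 has its own formula; it fits because `φ - vφ'` has constant term `φ(0)`.
  · rw [PowerSeries.coeff_succ_X_mul]
    simp only [lagrangeFunctional, PowerSeries.coeff_mk]
    rw [mul_assoc, mul_assoc, Polynomial.coeff_X_mul]
    simp [Polynomial.mul_coeff_zero, mul_comm]
  · rw [PowerSeries.coeff_succ_X_mul]
    simp only [lagrangeFunctional, PowerSeries.coeff_mk]
    rw [mul_assoc, mul_assoc, Polynomial.coeff_X_mul]
    congr 1
    ring

/-- `(n+1) φ^n (φ - vφ') = (n+1) φ^(n+1) - v (φ^(n+1))'`, and the right side has no term in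
`v^(n+1)`. -/
theorem lagrangeFunctional_one {R : Type*} [CommRing R] [IsDomain R] [CharZero R]
    (φ : Polynomial R) : lagrangeFunctional φ 1 = 1 := by
  ext n
  rcases n with _ | n
  · simp [lagrangeFunctional]
  · simp only [lagrangeFunctional, PowerSeries.coeff_mk, PowerSeries.coeff_one]
    have h1 : ((n : Polynomial R) + 1) * (1 * φ ^ n * (φ - Polynomial.X * φ.derivative)) =
        ((n : Polynomial R) + 1) * φ ^ (n + 1) -
          Polynomial.X * (φ ^ (n + 1)).derivative := by
      rw [Polynomial.derivative_pow_succ]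
      simp
      ring
    have h2 := congrArg (fun p => Polynomial.coeff p (n + 1)) h1
    have h3 : ((n : Polynomial R) + 1) = Polynomial.C ((n : R) + 1) := by simp
    simp only [h3, Polynomial.coeff_C_mul, Polynomial.coeff_sub, Polynomial.coeff_X_mul,
      Polynomial.coeff_derivative] at h2
    have h4 : ((n : R) + 1) ≠ 0 := by exact_mod_cast Nat.succ_ne_zero n
    have h5 : ((n : R) + 1) * (1 * φ ^ n * (φ - Polynomial.X * φ.derivative)).coeff (n + 1) = 0 := by
      rw [h2]; ring
    simpa using (mul_eq_zero.mp h5).resolve_left h4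

/-- Linearity, the value at 1 and the rule trading a factor `v` for `xφ` determine the functional,
one power of `x` at a time. Evaluation at `P` obeys the same rules. -/
theorem lagrangeFunctional_eq_aeval {R : Type*} [CommRing R] [IsDomain R] [CharZero R]
    (φ : Polynomial R) (P : R⟦X⟧) (hP : P = PowerSeries.X * Polynomial.aeval P φ)
    (f : Polynomial R) : lagrangeFunctional φ f = Polynomial.aeval P f := by
  have key : ∀ n : ℕ, ∀ f : Polynomial R,
      PowerSeries.coeff n (lagrangeFunctional φ f) = PowerSeries.coeff n (Polynomial.aeval P f) := by
    intro n
    induction n with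
    | zero =>
      intro f
      have h0 : PowerSeries.constantCoeff P = 0 := by rw [hP]; simp
      rw [← Polynomial.X_mul_divX_add f, lagrangeFunctional_add, lagrangeFunctional_X_mul,
        ← mul_one (Polynomial.C _), lagrangeFunctional_C_mul, lagrangeFunctional_one]
      rw [map_add (Polynomial.aeval P), map_mul (Polynomial.aeval P), Polynomial.aeval_X, mul_one, mul_one]
      simp [h0]
    | succ n ih =>
      intro f
      rw [← Polynomial.X_mul_divX_add f, lagrangeFunctional_add, lagrangeFunctional_X_mul,
        ← mul_one (Polynomial.C _), lagrangeFunctional_C_mul, lagrangeFunctional_one]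
      have h1 : Polynomial.aeval P (Polynomial.X * f.divX + Polynomial.C (f.coeff 0) * 1) =
          PowerSeries.X * Polynomial.aeval P (φ * f.divX) + PowerSeries.C (f.coeff 0) := by
        rw [map_add, map_mul, map_mul, Polynomial.aeval_X, map_mul, ← mul_assoc, ← hP]
        simp
      rw [h1, map_add, map_add, PowerSeries.coeff_succ_X_mul, PowerSeries.coeff_succ_X_mul, ih,
        mul_one]
  ext n
  exact key n f

/-- Lagrange inversion. -/
theorem lagrange_inversion {R : Type*} [CommRing R] [IsDomain R] [CharZero R]
    (φ : Polynomial R) (P : R⟦X⟧) (hP : P = PowerSeries.X * Polynomial.aeval P φ) (n : ℕ) :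
    ((n : R) + 1) * PowerSeries.coeff (n + 1) P = (φ ^ (n + 1)).coeff n := by
  have h := lagrangeFunctional_eq_aeval φ P hP Polynomial.X
  rw [Polynomial.aeval_X] at h
  rw [← h]
  simp only [lagrangeFunctional, PowerSeries.coeff_mk]
  rw [mul_assoc, Polynomial.coeff_X_mul]
  -- The identity behind `lagrangeFunctional_one`, now read at `v^n`, where the factor `(n+1) - n =
  -- 1` survives.
  have h1 : ((n : Polynomial R) + 1) * (φ ^ n * (φ - Polynomial.X * φ.derivative)) =
      ((n : Polynomial R) + 1) * φ ^ (n + 1) - Polynomial.X * (φ ^ (n + 1)).derivative := by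
    rw [Polynomial.derivative_pow_succ]
    simp
    ring
  have h2 := congrArg (fun p => Polynomial.coeff p n) h1
  have h3 : ((n : Polynomial R) + 1) = Polynomial.C ((n : R) + 1) := by simp
  simp only [h3, Polynomial.coeff_C_mul, Polynomial.coeff_sub] at h2
  rw [h2]
  rcases n with _ | n
  · simp
  · simp only [Polynomial.coeff_X_mul, Polynomial.coeff_derivative]
    push_cast
    ring

/-- The coefficients of the solution of `P = x (1 + s P) (1 + P) ^ 2`. -/
theorem coeff_coeff_of_eq_X_mul (P : (Polynomial ℚ)⟦X⟧)
    (hP : P = PowerSeries.X * ((1 + PowerSeries.C Polynomial.X * P) * (1 + P) ^ 2)) (n k : ℕ) :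
    ((n : ℚ) + 1) * (PowerSeries.coeff (n + 1) P).coeff k =
      if k ≤ n then ((n + 1).choose k * (2 * (n + 1)).choose (n - k) : ℚ) else 0 := by
  have h := lagrange_inversion
    ((1 + Polynomial.C Polynomial.X * Polynomial.X) * (1 + Polynomial.X) ^ 2) P
    (by simpa [PowerSeries.algebraMap_apply] using hP) n
  rw [mul_pow, ← pow_mul, Polynomial.coeff_mul] at h
  have h1 : ∀ i : ℕ, ((1 + Polynomial.C (Polynomial.X : Polynomial ℚ) * Polynomial.X) ^
      (n + 1)).coeff i = (n + 1).choose i * Polynomial.X ^ i := by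
    intro i
    have : (1 + Polynomial.C (Polynomial.X : Polynomial ℚ) * Polynomial.X) ^ (n + 1) =
        ((1 + Polynomial.X) ^ (n + 1)).comp
          (Polynomial.C (Polynomial.X : Polynomial ℚ) * Polynomial.X) := by
      simp
    rw [this, Polynomial.comp_C_mul_X_coeff, Polynomial.coeff_one_add_X_pow]
  have h2 := congrArg (fun p => Polynomial.coeff p k) h
  simp only [h1, Polynomial.coeff_one_add_X_pow, Polynomial.finsetSum_coeff] at h2
  have h3 : ((n : Polynomial ℚ) + 1) = Polynomial.C ((n : ℚ) + 1) := by simp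
  rw [h3, Polynomial.coeff_C_mul] at h2
  rw [h2]
  have h4 : ∀ p : ℕ × ℕ, k ≠ p.1 → (((n + 1).choose p.1 : Polynomial ℚ) * Polynomial.X ^ p.1 *
      ((2 * (n + 1)).choose p.2 : Polynomial ℚ)).coeff k = 0 := by
    intro p hp
    simp [Polynomial.coeff_natCast_mul, Polynomial.coeff_mul_natCast, Polynomial.coeff_X_pow, hp]
  split_ifs with hk
  · rw [Finset.sum_eq_single (k, n - k)]
    · simp [Polynomial.coeff_natCast_mul, Polynomial.coeff_mul_natCast, Polynomial.coeff_X_pow]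
    · rintro ⟨i, j⟩ hij hne
      apply h4
      rintro rfl
      apply hne
      rw [Finset.HasAntidiagonal.mem_antidiagonal] at hij
      rw [Prod.mk.injEq]
      exact ⟨rfl, by omega⟩
    · intro h
      rw [Finset.HasAntidiagonal.mem_antidiagonal] at h
      omega
  · apply Finset.sum_eq_zero
    intro p hp
    rw [Finset.HasAntidiagonal.mem_antidiagonal] at hp
    exact h4 p (by omega)

end Lagrange

/-! ### Fertility of words and its generating function. -/

section Words

open PowerSeries

/-- The sum of `f u * h v` over the ways to write `w = u v`, plus the sum of
`f (u 0) * h (0 v)` over the ways to write `w = u 1 v`. -/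
def splitConv {R : Type*} [Semiring R] (f h : List Bool → R) : List Bool → R
  | [] => f [] * h []
  | b :: w => f [] * h (b :: w) + (if b then f [false] * h (false :: w) else 0) +
      splitConv (fun u => f (b :: u)) h w

theorem splitConv_congr {R : Type*} [Semiring R] {w : List Bool} {f f' h h' : List Bool → R}
    (hf : ∀ u, u.length ≤ w.length → f u = f' u) (hh : ∀ u, u.length ≤ w.length → h u = h' u) :
    splitConv f h w = splitConv f' h' w := by
  induction w generalizing f f' with
  | nil => simp [splitConv, hf, hh]
  | cons b w ih =>
    simp only [splitConv]
    rw [hf [] (by simp), hh (b :: w) le_rfl, hf [false] (by simp), hh (false :: w) (by simp),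
      ih (f' := fun u => f' (b :: u)) (fun u hu => hf _ (by simpa using hu))
        (fun u hu => hh _ (hu.trans (by simp)))]

theorem cast_splitConv (f h : List Bool → ℕ) {R : Type*} [Semiring R] (w : List Bool) :
    ((splitConv f h w : ℕ) : R) = splitConv (fun u => (f u : R)) (fun u => (h u : R)) w := by
  induction w generalizing f with
  | nil => simp [splitConv]
  | cons b w ih => cases b <;> simp [splitConv, ih]

/-- `fertility` computed with a bound `n` on the length of the word. -/
def fertilityAux : ℕ → List Bool → ℕ
  | 0, _ => 1
  | n + 1, w => match w.reverse with
    | [] => 1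
    | true :: _ => 0
    | false :: v => splitConv (fertilityAux n) (fertilityAux n) v.reverse

theorem fertilityAux_eq {n m : ℕ} {w : List Bool} (hn : w.length ≤ n) (hm : w.length ≤ m) :
    fertilityAux n w = fertilityAux m w := by
  induction n generalizing m w with
  | zero =>
    obtain rfl : w = [] := by simpa using hn
    cases m <;> simp [fertilityAux]
  | succ n ih =>
    cases m with
    | zero =>
      obtain rfl : w = [] := by simpa using hm
      simp [fertilityAux]
    | succ m =>
      induction w using List.reverseRecOn with
      | nil => simp [fertilityAux]
      | append_singleton v b _ =>
        cases b
        · simp only [fertilityAux, List.reverse_append, List.reverse_cons, List.reverse_nil,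
            List.nil_append, List.singleton_append, List.reverse_reverse]
          simp only [List.length_append, List.length_singleton] at hn hm
          apply splitConv_congr <;> exact fun u hu => ih (by omega) (by omega)
        · simp [fertilityAux]

/-- The number of preimages under the stack-sorting map of the layered permutation coded by a
word, where `false` codes a layer of size 1 and `true` a layer of size 2. -/
def fertility (w : List Bool) : ℕ := fertilityAux w.length w

theorem fertility_nil : fertility [] = 1 := rfl

theorem fertility_append_true (w : List Bool) : fertility (w ++ [true]) = 0 := by
  simp [fertility, fertilityAux]

theorem fertility_append_false (w : List Bool) :
    fertility (w ++ [false]) = splitConv fertility fertility w := by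
  simp only [fertility, List.length_append, List.length_singleton, fertilityAux,
    List.reverse_append, List.reverse_cons, List.reverse_nil,
    List.nil_append, List.singleton_append, List.reverse_reverse]
  apply splitConv_congr <;> exact fun u hu => fertilityAux_eq hu le_rfl

/-- The words of length `n` in the letters `false` and `true`. -/
def wordsOfLength : ℕ → Finset (List Bool)
  | 0 => {[]}
  | n + 1 => (wordsOfLength n).image (List.cons false) ∪ (wordsOfLength n).image (List.cons true)

theorem mem_wordsOfLength {n : ℕ} {w : List Bool} : w ∈ wordsOfLength n ↔ w.length = n := by
  induction n generalizing w with
  | zero => simp [wordsOfLength]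
  | succ n ih =>
    rcases w with _ | ⟨_ | _, w⟩ <;> simp [wordsOfLength, ih]

/-- The sum of `f w` over the words of length `n`, weighted by `s` to the number of letters
`true`. -/
noncomputable def weightedSum (n : ℕ) (f : List Bool → Polynomial ℚ) : Polynomial ℚ :=
  ∑ w ∈ wordsOfLength n, Polynomial.X ^ (w.count true) * f w

theorem weightedSum_zero (f : List Bool → Polynomial ℚ) : weightedSum 0 f = f [] := by
  simp [weightedSum, wordsOfLength]

theorem weightedSum_succ (n : ℕ) (f : List Bool → Polynomial ℚ) :
    weightedSum (n + 1) f = weightedSum n (fun w => f (false :: w)) +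
      Polynomial.X * weightedSum n (fun w => f (true :: w)) := by
  unfold weightedSum
  rw [wordsOfLength, Finset.sum_union, Finset.sum_image, Finset.sum_image, Finset.mul_sum]
  · congr 1
    apply Finset.sum_congr rfl
    intro w _
    rw [List.count_cons_self, pow_succ]
    ring
  · simp [Set.InjOn]
  · simp [Set.InjOn]
  · rw [Finset.disjoint_left]
    simp

/-- The generating function of `f` by length and by number of letters `true`. -/
noncomputable def wordSeries (f : List Bool → Polynomial ℚ) : (Polynomial ℚ)⟦X⟧ :=
  PowerSeries.mk fun n => weightedSum n f

theorem wordSeries_add (f h : List Bool → Polynomial ℚ) :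
    wordSeries (fun w => f w + h w) = wordSeries f + wordSeries h := by
  ext1 n
  simp [wordSeries, weightedSum, mul_add, Finset.sum_add_distrib]

theorem wordSeries_const_mul (c : Polynomial ℚ) (f : List Bool → Polynomial ℚ) :
    wordSeries (fun w => c * f w) = PowerSeries.C c * wordSeries f := by
  ext1 n
  simp [wordSeries, weightedSum, Finset.mul_sum, mul_left_comm]

theorem wordSeries_zero : wordSeries (fun _ => 0) = 0 := by
  ext1 n
  simp [wordSeries, weightedSum]

theorem wordSeries_cons (f : List Bool → Polynomial ℚ) :
    wordSeries f = PowerSeries.C (f []) + X * (wordSeries (fun w => f (false :: w)) +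
      PowerSeries.C Polynomial.X * wordSeries (fun w => f (true :: w))) := by
  ext1 n
  cases n with
  | zero => simp [wordSeries, weightedSum_zero]
  | succ n =>
    rw [map_add, coeff_succ_X_mul]
    simp [wordSeries, weightedSum_succ]

theorem wordSeries_snoc (f : List Bool → Polynomial ℚ) :
    wordSeries f = PowerSeries.C (f []) + X * (wordSeries (fun w => f (w ++ [false])) +
      PowerSeries.C Polynomial.X * wordSeries (fun w => f (w ++ [true]))) := by
  have key : ∀ n (f : List Bool → Polynomial ℚ), weightedSum (n + 1) f =
      weightedSum n (fun w => f (w ++ [false])) +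
        Polynomial.X * weightedSum n (fun w => f (w ++ [true])) := by
    intro n
    induction n with
    | zero => intro f; simp [weightedSum_succ, weightedSum_zero]
    | succ n ih =>
      intro f
      rw [weightedSum_succ, ih, ih, weightedSum_succ n, weightedSum_succ n]
      simp only [List.cons_append]
      ring
  ext1 n
  cases n with
  | zero => simp [wordSeries, weightedSum_zero]
  | succ n =>
    rw [map_add, coeff_succ_X_mul]
    simp [wordSeries, key]

/-- The product accounts for cuts between letters; the other term for cuts inside a letter `true`,
whose weight is `xs`. The defect of the identity, as a function of `f`, satisfies a homogeneous
recursion with a factor `x`, so all its coefficients vanish. -/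
theorem wordSeries_splitConv (f h : List Bool → Polynomial ℚ) :
    wordSeries (splitConv f h) = wordSeries f * wordSeries h +
      X * PowerSeries.C Polynomial.X * wordSeries (fun w => f (w ++ [false])) *
        wordSeries (fun w => h (false :: w)) := by
  set Z : (List Bool → Polynomial ℚ) → (Polynomial ℚ)⟦X⟧ := fun f =>
    wordSeries (splitConv f h) - (wordSeries f * wordSeries h +
      X * PowerSeries.C Polynomial.X * wordSeries (fun w => f (w ++ [false])) *
        wordSeries (fun w => h (false :: w))) with hZ
  have hrec : ∀ f, Z f = X * (Z (fun w => f (false :: w)) +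
      PowerSeries.C Polynomial.X * Z (fun w => f (true :: w))) := by
    intro f
    have h1 := wordSeries_cons (splitConv f h)
    simp only [splitConv, if_true, Bool.false_eq_true, if_false, add_zero, wordSeries_add,
      wordSeries_const_mul, map_mul] at h1
    have h2 := wordSeries_cons h
    have h3 := wordSeries_cons (fun w => f (w ++ [false]))
    simp only [List.cons_append, List.nil_append] at h3
    simp only [hZ]
    rw [h1, h3, wordSeries_cons f]
    linear_combination (-PowerSeries.C (f [])) * h2
  have hzero : ∀ n f, coeff n (Z f) = 0 := by
    intro n
    induction n with
    | zero => intro f; rw [hrec]; simp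
    | succ n ih => intro f; rw [hrec, coeff_succ_X_mul]; simp [ih]
  have : Z f = 0 := by ext1 n; simp [hzero]
  exact sub_eq_zero.mp this

/-- The generating function of `fertility`. -/
noncomputable def fertilitySeries : (Polynomial ℚ)⟦X⟧ :=
  wordSeries fun w => (fertility w : Polynomial ℚ)

theorem fertilitySeries_sub_one :
    fertilitySeries - 1 = X * ((1 + PowerSeries.C Polynomial.X * (fertilitySeries - 1)) *
      (1 + (fertilitySeries - 1)) ^ 2) := by
  set F := fertilitySeries with hF
  set a := wordSeries (fun w => (fertility (w ++ [false]) : Polynomial ℚ)) with ha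
  set b := wordSeries (fun w => (fertility (false :: w) : Polynomial ℚ)) with hb
  set m := wordSeries (fun w => (fertility (false :: (w ++ [false])) : Polynomial ℚ)) with hm
  set s : (Polynomial ℚ)⟦X⟧ := PowerSeries.C Polynomial.X with hs
  have hz := fertility_append_true
  have hz' : ∀ w, fertility (false :: (w ++ [true])) = 0 := fun w =>
    fertility_append_true (false :: w)
  have e1 : F = 1 + X * a := by
    rw [hF, fertilitySeries, wordSeries_snoc]
    simp [hz, wordSeries_zero, fertility_nil, ha]
  have e2 : b = 1 + X * m := by
    rw [hb, wordSeries_snoc]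
    have : fertility [false] = 1 := by
      rw [← List.nil_append [false], fertility_append_false]; simp [splitConv, fertility_nil]
    simp [hz', wordSeries_zero, hm, this]
  have e3 : a = F ^ 2 + X * s * a * b := by
    have ha' : a = wordSeries (splitConv (fun u => (fertility u : Polynomial ℚ))
        (fun u => (fertility u : Polynomial ℚ))) := by
      rw [ha]
      simp only [fertility_append_false, cast_splitConv]
    refine ha'.trans ?_
    rw [wordSeries_splitConv]
    change F * F + X * s * a * b = _
    ring
  have e4 : m = b + b * F + X * s * m * b := by
    have hm' : m = wordSeries (fun w => splitConv (fun u => (fertility u : Polynomial ℚ))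
        (fun u => (fertility u : Polynomial ℚ)) (false :: w)) := by
      rw [hm]
      congr 1
      funext w
      rw [← List.cons_append, fertility_append_false, cast_splitConv]
    refine hm'.trans ?_
    simp only [splitConv, fertility_nil, Bool.false_eq_true, if_false, add_zero, wordSeries_add,
      Nat.cast_one, one_mul]
    rw [wordSeries_splitConv]
    change b + (b * F + X * s * m * b) = _
    ring
  -- Eliminating `a` and `m` shows that `b = F^2`, up to a factor with constant term 1.
  have e5 : (b - F ^ 2) * (1 - X * (s * b + 1 + F)) = 0 := by
    have hx : (b - F ^ 2) = X * (m - a * (1 + F)) := by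
      linear_combination e2 - (1 + F) * e1
    have hd : (m - a * (1 + F)) * (1 - X * s * b) = (b - F ^ 2) * (1 + F) := by
      linear_combination e4 - (1 + F) * e3
    linear_combination (1 - X * s * b) * hx + X * hd
  have e6 : (1 - X * (s * b + 1 + F)) ≠ 0 := by
    intro h
    have := congrArg constantCoeff h
    simp at this
  have e7 : b = F ^ 2 := sub_eq_zero.mp ((mul_eq_zero.mp e5).resolve_right e6)
  rw [e7] at e3
  linear_combination e1 + X * e3 - X * s * F ^ 2 * e1

theorem coeff_fertilitySeries (n k : ℕ) : (coeff n fertilitySeries).coeff k =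
    ∑ w ∈ (wordsOfLength n).filter (fun w => w.count true = k), (fertility w : ℚ) := by
  rw [fertilitySeries, wordSeries, coeff_mk, weightedSum, Polynomial.finsetSum_coeff,
    Finset.sum_filter]
  apply Finset.sum_congr rfl
  intro w _
  rw [Polynomial.coeff_mul_natCast, Polynomial.coeff_X_pow]
  simp [eq_comm]

end Words

/-! ### Compositions under the dominance order and Catalan weights. -/

section Compositions

open PowerSeries

/-- The lists of `a` positive integers with sum `b`. -/
def compLists : ℕ → ℕ → Finset (List ℕ)
  | 0, b => if b = 0 then {[]} else ∅
  | a + 1, b => (Finset.Icc 1 b).biUnion fun j => (compLists a (b - j)).image (List.cons j)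

theorem mem_compLists {a b : ℕ} {l : List ℕ} :
    l ∈ compLists a b ↔ l.length = a ∧ l.sum = b ∧ ∀ x ∈ l, 0 < x := by
  induction a generalizing b l with
  | zero =>
    by_cases hb : b = 0
    · simp only [compLists, hb, if_true, Finset.mem_singleton, List.length_eq_zero_iff]
      constructor
      · rintro rfl; simp
      · exact fun h => h.1
    · simp only [compLists, hb, if_false, Finset.notMem_empty, List.length_eq_zero_iff, false_iff]
      rintro ⟨rfl, h, _⟩
      exact hb (by simpa using h.symm)
  | succ a ih =>
    rcases l with _ | ⟨q, l⟩
    · simp [compLists]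
    · simp only [compLists, Finset.mem_biUnion, Finset.mem_Icc, Finset.mem_image, ih,
        List.length_cons, List.sum_cons, List.mem_cons, forall_eq_or_imp, List.cons.injEq]
      constructor
      · rintro ⟨j, hj, l', ⟨h1, h2, h3⟩, rfl, rfl⟩
        exact ⟨by omega, by omega, by omega, h3⟩
      · rintro ⟨h1, h2, h3, h4⟩
        exact ⟨q, by omega, l, ⟨by omega, by omega, h4⟩, rfl, rfl⟩

theorem sum_compLists_succ {R : Type*} [AddCommMonoid R] (a b : ℕ) (f : List ℕ → R) :
    ∑ l ∈ compLists (a + 1) b, f l =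
      ∑ j ∈ Finset.Icc 1 b, ∑ l ∈ compLists a (b - j), f (j :: l) := by
  rw [compLists, Finset.sum_biUnion]
  · apply Finset.sum_congr rfl
    intro j _
    rw [Finset.sum_image]
    simp [Set.InjOn]
  · intro i _ j _ hij
    rw [Function.onFun, Finset.disjoint_left]
    simp only [Finset.mem_image, not_exists, not_and]
    rintro _ ⟨l, _, rfl⟩ l' _ h
    exact hij (List.cons.inj h).1.symm

theorem sum_Comp {R : Type*} [AddCommMonoid R] (a b : ℕ) (f : List ℕ → R) :
    ∑ q ∈ Comp a b, f q.blocks = ∑ l ∈ compLists a b, f l := by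
  refine Finset.sum_bij (fun q _ => q.blocks) ?_ ?_ ?_ (fun _ _ => rfl)
  · intro q hq
    rw [mem_compLists]
    exact ⟨by simpa [Comp] using hq, q.blocks_sum, fun x hx => q.blocks_pos hx⟩
  · intro q _ q' _ h
    exact Composition.ext h
  · intro l hl
    rw [mem_compLists] at hl
    exact ⟨⟨l, fun {i} hi => hl.2.2 i hi, hl.2.1⟩, by simpa [Comp, Composition.length] using hl.1, rfl⟩

/-- Every partial sum of `ys` is at most `h` plus that of `qs`. -/
def Dominated (h : ℕ) (ys qs : List ℕ) : Prop :=
  ∀ l, (ys.take l).sum ≤ h + (qs.take l).sum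

theorem dominated_cons {h y q : ℕ} {ys qs : List ℕ} :
    Dominated h (y :: ys) (q :: qs) ↔ y ≤ h + q ∧ Dominated (h + q - y) ys qs := by
  constructor
  · intro H
    have h1 := H 1
    simp only [List.take_succ_cons, List.take_zero, List.sum_cons, List.sum_nil] at h1
    refine ⟨by omega, fun l => ?_⟩
    have h2 := H (l + 1)
    simp only [List.take_succ_cons, List.sum_cons] at h2
    omega
  · rintro ⟨h1, H⟩ l
    cases l with
    | zero => simp
    | succ l =>
      have h2 := H l
      simp only [List.take_succ_cons, List.sum_cons]
      omega

open Classical in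
/-- The number of `ys` with as many parts as `qs` that are dominated by `qs` from height `h` and
whose sum is the largest possible. -/
noncomputable def dominatedCount (h : ℕ) (qs : List ℕ) : ℕ :=
  ∑ ys ∈ compLists qs.length (h + qs.sum), if Dominated h ys qs then 1 else 0

theorem dominatedCount_nil (h : ℕ) : dominatedCount h [] = if h = 0 then 1 else 0 := by
  by_cases hh : h = 0 <;> simp [dominatedCount, compLists, Dominated, hh]

/-- The index `i = h + q - y` is the slack left after a first part `y`; `y ≥ 1` gives `i < h + q`.
-/
theorem dominatedCount_cons (h q : ℕ) (qs : List ℕ) :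
    dominatedCount h (q :: qs) = ∑ i ∈ Finset.range (h + q), dominatedCount i qs := by
  classical
  rw [dominatedCount, List.length_cons, sum_compLists_succ]
  have h1 : ∑ j ∈ Finset.Icc 1 (h + q), dominatedCount (h + q - j) qs =
      ∑ j ∈ Finset.Icc 1 (h + (q :: qs).sum), ∑ l ∈ compLists qs.length (h + (q :: qs).sum - j),
        if Dominated h (j :: l) (q :: qs) then 1 else 0 := by
    refine (Finset.sum_congr rfl ?_).trans
      (Finset.sum_subset (Finset.Icc_subset_Icc le_rfl ?_) ?_)
    · intro j hj
      rw [Finset.mem_Icc] at hj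
      rw [dominatedCount, List.sum_cons,
        show h + (q + qs.sum) - j = h + q - j + qs.sum by omega]
      simp only [dominated_cons, hj.2, true_and]
    · rw [List.sum_cons]
      omega
    · intro j hj hj'
      rw [Finset.mem_Icc] at hj hj'
      apply Finset.sum_eq_zero
      intro l _
      rw [if_neg]
      rw [dominated_cons]
      omega
  rw [← h1]
  refine Finset.sum_nbij' (fun j => h + q - j) (fun i => h + q - i) ?_ ?_ ?_ ?_ ?_
  · intro j hj; simp at hj ⊢; omega
  · intro j hj; simp at hj ⊢; omega
  · intro j hj; simp at hj ⊢; omega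
  · intro j hj; simp at hj ⊢; omega
  · intro j hj; rfl

/-- Comparing partial sums at every `l` costs nothing: they are 0 at `l = 0`, and past the last part
both equal `b`. -/
theorem compD_eq {b : ℕ} (q : Composition b) : compD q = dominatedCount 0 q.blocks := by
  classical
  rw [compD, Finset.card_filter, dominatedCount, Nat.zero_add, q.blocks_sum, q.blocks_length,
    ← sum_Comp]
  apply Finset.sum_congr rfl
  intro y hy
  have hy : y.length = q.length := by simpa [Comp] using hy
  congr 1
  rw [eq_iff_iff]
  constructor
  · intro H l
    rw [zero_add]
    by_cases hl : l ∈ Finset.Icc 1 q.length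
    · exact H l hl
    · rw [Finset.mem_Icc] at hl
      rcases Nat.eq_zero_or_pos l with rfl | hl0
      · simp
      · rw [List.take_of_length_le (by rw [y.blocks_length]; omega),
          List.take_of_length_le (by rw [q.blocks_length]; omega), y.blocks_sum, q.blocks_sum]
  · intro H l _
    simpa [Composition.sizeUpTo] using H l

/-- The sum of `C_q` times `dominatedCount h q` over the compositions `q` of `b` into `a` parts. -/
noncomputable def dominatedSum (h a b : ℕ) : ℕ :=
  ∑ l ∈ compLists a b, (l.map catalan).prod * dominatedCount h l

theorem dominatedSum_zero (h b : ℕ) :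
    dominatedSum h 0 b = if b = 0 ∧ h = 0 then 1 else 0 := by
  by_cases hb : b = 0 <;> simp [dominatedSum, compLists, hb, dominatedCount_nil]

theorem dominatedSum_succ (h a b : ℕ) :
    dominatedSum h (a + 1) b = ∑ j ∈ Finset.Icc 1 b, catalan j *
      ∑ i ∈ Finset.range (h + j), dominatedSum i a (b - j) := by
  rw [dominatedSum, sum_compLists_succ]
  apply Finset.sum_congr rfl
  intro j _
  simp only [dominatedSum]
  rw [Finset.sum_comm, Finset.mul_sum]
  apply Finset.sum_congr rfl
  intro l _
  rw [dominatedCount_cons, List.map_cons, List.prod_cons, mul_assoc, Finset.mul_sum]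

theorem sum_Comp_compC_mul_compD (a b : ℕ) :
    ∑ q ∈ Comp a b, compC q * compD q = dominatedSum 0 a b := by
  simp only [compD_eq, compC]
  exact sum_Comp a b fun l => (l.map catalan).prod * dominatedCount 0 l

/-- Both sides solve `Q = 1 + XU Q^2`. Their difference is killed by a series with constant term 1,
hence is zero. -/
theorem one_add_eq_subst_catalanSeries {R : Type*} [CommRing R] [IsDomain R] (P U : R⟦X⟧)
    (hP : P = X * (U * (1 + P) ^ 2)) :
    1 + P = (PowerSeries.map (Nat.castRingHom R) catalanSeries).subst (X * U) := by
  have hs : HasSubst (X * U) := HasSubst.of_constantCoeff_zero' (by simp)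
  set C := PowerSeries.map (Nat.castRingHom R) catalanSeries with hC
  have h1 : C ^ 2 * X + 1 = C := by
    have := congrArg (PowerSeries.map (Nat.castRingHom R)) catalanSeries_sq_mul_X_add_one
    simpa using this
  set Q := C.subst (X * U) with hQ
  have h2 : Q ^ 2 * (X * U) + 1 = Q := by
    have := congrArg (substAlgHom (R := R) hs) h1
    rwa [map_add, map_mul, map_pow, map_one, coe_substAlgHom, subst_X hs] at this
  have h3 : (1 + P - Q) * (1 - X * U * (1 + P + Q)) = 0 := by
    linear_combination hP + h2
  have h4 : (1 - X * U * (1 + P + Q)) ≠ 0 := by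
    intro h
    have := congrArg constantCoeff h
    simp at this
  exact sub_eq_zero.mp ((mul_eq_zero.mp h3).resolve_right h4)

theorem coeff_mul_pow_eq_sum_catalan {R : Type*} [CommRing R] [IsDomain R] (P U : R⟦X⟧)
    (hP : P = X * (U * (1 + P) ^ 2)) (n h : ℕ) :
    coeff n (P * U ^ h) =
      ∑ j ∈ Finset.Icc 1 n, (catalan j : R) * coeff (n - j) (U ^ (h + j)) := by
  have hs : HasSubst (X * U) := HasSubst.of_constantCoeff_zero' (by simp)
  have h1 : ∀ i ≤ n, coeff i (1 + P) =
      coeff i (∑ d ∈ Finset.range (n + 1), PowerSeries.C (catalan d : R) * (X * U) ^ d) := by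
    intro i hi
    rw [one_add_eq_subst_catalanSeries P U hP, coeff_subst' hs, map_sum,
      finsum_eq_sum_of_support_subset (s := Finset.range (n + 1))]
    · apply Finset.sum_congr rfl
      intro d _
      rw [coeff_C_mul, coeff_map, catalanSeries_coeff, smul_eq_mul, eq_natCast]
    · intro d hd
      simp only [Finset.coe_range, Set.mem_Iio]
      by_contra hlt
      apply hd
      beta_reduce
      rw [mul_pow, coeff_X_pow_mul', if_neg (by omega), smul_zero]
  have h2 : coeff n ((1 + P) * U ^ h) = coeff n
      ((∑ d ∈ Finset.range (n + 1), PowerSeries.C (catalan d : R) * (X * U) ^ d) * U ^ h) := by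
    rw [coeff_mul, coeff_mul]
    apply Finset.sum_congr rfl
    intro p hp
    rw [h1 p.1 (by rw [Finset.HasAntidiagonal.mem_antidiagonal] at hp; omega)]
  -- The split-off term `d = 0` is `U^h`, which cancels the 1 in `(1 + P) U^h`.
  rw [Finset.sum_mul, map_sum, Finset.sum_range_succ', add_mul, map_add] at h2
  have h3 : ∑ j ∈ Finset.Icc 1 n, (catalan j : R) * coeff (n - j) (U ^ (h + j)) =
      ∑ j ∈ Finset.range n, coeff n
        (PowerSeries.C (catalan (j + 1) : R) * (X * U) ^ (j + 1) * U ^ h) := by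
    rw [← Finset.Ico_add_one_right_eq_Icc, Finset.sum_Ico_eq_sum_range]
    apply Finset.sum_congr (by simp)
    intro j hj
    rw [Finset.mem_range] at hj
    rw [mul_assoc, coeff_C_mul, mul_pow, mul_assoc, coeff_X_pow_mul', if_pos (by omega),
      ← pow_add, add_comm 1 j, add_comm h]
  rw [h3]
  simp only [pow_zero, mul_one, catalan_zero, Nat.cast_one, map_one, one_mul] at h2
  linear_combination h2

/-- Induction on `a`, then on `h`: raising `h` by one adds `s P U^h`, and the factor `s` lowers `a`.
The case `a = h = 0` must be excluded, since there an empty sum faces the constant series 1. -/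
theorem sum_dominatedSum_eq_coeff (P : (Polynomial ℚ)⟦X⟧)
    (hP : P = X * ((1 + PowerSeries.C Polynomial.X * P) * (1 + P) ^ 2)) (a h n : ℕ)
    (hah : a ≠ 0 ∨ h ≠ 0) :
    ((∑ i ∈ Finset.range h, dominatedSum i a n : ℕ) : ℚ) =
      (coeff n ((1 + PowerSeries.C Polynomial.X * P) ^ h)).coeff a := by
  set U := 1 + PowerSeries.C Polynomial.X * P with hU
  induction a generalizing h n with
  | zero =>
    have h0 : h ≠ 0 := by simpa using hah
    have h1 : PowerSeries.map Polynomial.constantCoeff (U ^ h) = 1 := by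
      simp [hU]
    have h2 := congrArg (coeff n) h1
    rw [coeff_map, Polynomial.constantCoeff_apply, coeff_one] at h2
    rw [h2]
    simp only [dominatedSum_zero]
    by_cases hn : n = 0
    · simp [hn, Nat.pos_of_ne_zero h0]
    · simp [hn]
  | succ a ih =>
    clear hah
    induction h with
    | zero =>
      simp only [Finset.range_zero, Finset.sum_empty, pow_zero, coeff_one]
      split_ifs <;> simp [Polynomial.coeff_one]
    | succ h ihh =>
      have h1 : U ^ (h + 1) = U ^ h + PowerSeries.C Polynomial.X * (P * U ^ h) := by
        rw [pow_succ]; simp only [hU]; ring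
      rw [Finset.sum_range_succ, Nat.cast_add, ihh, h1, map_add, coeff_C_mul, Polynomial.coeff_add,
        Polynomial.coeff_X_mul, coeff_mul_pow_eq_sum_catalan P U hP, dominatedSum_succ,
        Polynomial.finsetSum_coeff]
      congr 1
      push_cast
      apply Finset.sum_congr rfl
      intro j hj
      rw [Finset.mem_Icc] at hj
      rw [Polynomial.coeff_natCast_mul, ← ih (h + j) (n - j) (Or.inr (by omega))]
      push_cast
      rfl

/-- The case `h = 1`: in `U = 1 + sP` the exponent of `s` is shifted by one, so `k + 1` parts
correspond to `s^k`. -/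
theorem sum_Comp_eq_coeff (P : (Polynomial ℚ)⟦X⟧)
    (hP : P = X * ((1 + PowerSeries.C Polynomial.X * P) * (1 + P) ^ 2)) (k n : ℕ) :
    ((∑ q ∈ Comp (k + 1) n, compC q * compD q : ℕ) : ℚ) = (coeff n P).coeff k := by
  have h := sum_dominatedSum_eq_coeff P hP (k + 1) 1 n (Or.inr one_ne_zero)
  rw [sum_Comp_compC_mul_compD]
  rw [Finset.sum_range_one, pow_one, map_add, coeff_C_mul, Polynomial.coeff_add,
    Polynomial.coeff_X_mul, coeff_one] at h
  rw [h]
  split_ifs <;> simp [Polynomial.coeff_one]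

end Compositions

/-! ### Preimages under stack-sorting. -/

section StackSort

theorem leftOf_append_cons {m : ℕ} {L R : List ℕ} (h : m ∉ L) : leftOf m (L ++ m :: R) = L := by
  simp [leftOf, List.idxOf_append_of_notMem h]

theorem rightOf_append_cons {m : ℕ} {L R : List ℕ} (h : m ∉ L) : rightOf m (L ++ m :: R) = R := by
  simp [rightOf, List.idxOf_append_of_notMem h]

theorem leftOf_append_rightOf {m : ℕ} {π : List ℕ} (h : m ∈ π) :
    leftOf m π ++ m :: rightOf m π = π := by
  obtain ⟨L, R, rfl, hL⟩ := List.eq_append_cons_of_mem h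
  rw [leftOf_append_cons hL, rightOf_append_cons hL]

theorem stackSort_nil : stackSort [] = [] := by
  rw [stackSort]; simp

theorem stackSort_of_ne_nil {π : List ℕ} (h : π ≠ []) :
    stackSort π = stackSort (leftOf (π.max h) π) ++ stackSort (rightOf (π.max h) π) ++
      [π.max h] := by
  rw [stackSort, dif_neg h]

theorem stackSort_append_cons {m : ℕ} {L R : List ℕ} (hL : ∀ x ∈ L, x < m)
    (hR : ∀ x ∈ R, x < m) :
    stackSort (L ++ m :: R) = stackSort L ++ stackSort R ++ [m] := by
  have hne : L ++ m :: R ≠ [] := by simp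
  have hmax : (L ++ m :: R).max hne = m := by
    apply le_antisymm
    · have h := List.max_mem hne
      simp only [List.mem_append, List.mem_cons] at h
      rcases h with h | h | h
      · exact (hL _ h).le
      · exact h.le
      · exact (hR _ h).le
    · exact List.le_max_of_mem (by simp)
  have hm : m ∉ L := fun h => lt_irrefl _ (hL m h)
  rw [stackSort_of_ne_nil hne, hmax, leftOf_append_cons hm, rightOf_append_cons hm]

theorem stackSort_perm (π : List ℕ) : (stackSort π).Perm π := by
  induction hn : π.length using Nat.strong_induction_on generalizing π with
  | _ n ih =>
    by_cases h : π = []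
    · rw [h, stackSort_nil]
    · have hm := List.max_mem h
      rw [stackSort_of_ne_nil h]
      have h1 := ih _ (hn ▸ length_leftOf_lt hm) _ rfl
      have h2 := ih _ (hn ▸ length_rightOf_lt hm) _ rfl
      conv_rhs => rw [← leftOf_append_rightOf hm]
      rw [List.append_assoc]
      exact h1.append ((h2.append_right _).trans (List.perm_append_singleton _ _))

theorem finite_stackSortPreimage_singleton (σ : List ℕ) : (stackSortPreimage {σ}).Finite := by
  apply (σ.permutations.toFinset.finite_toSet).subset
  rintro π ⟨_, h⟩
  rw [Set.mem_singleton_iff] at h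
  simp only [Finset.mem_coe, List.mem_toFinset, List.mem_permutations]
  exact h ▸ (stackSort_perm π).symm

theorem stackSortPreimage_nil : stackSortPreimage {[]} = {[]} := by
  ext π
  simp only [stackSortPreimage, Set.mem_singleton_iff, Set.mem_ofPred_eq]
  constructor
  · rintro ⟨_, h⟩
    have := stackSort_perm π
    rw [h] at this
    exact this.symm.eq_nil
  · rintro rfl
    exact ⟨⟨List.nodup_nil, by simp⟩, stackSort_nil⟩

/-- An image of the map ends with its largest entry. -/
theorem stackSortPreimage_eq_empty {τ : List ℕ} {a b : ℕ} (hab : a < b) :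
    stackSortPreimage {τ ++ [b, a]} = ∅ := by
  rw [Set.eq_empty_iff_forall_notMem]
  rintro π ⟨_, h⟩
  rw [Set.mem_singleton_iff] at h
  have hne : π ≠ [] := by
    rintro rfl
    rw [stackSort_nil] at h
    simp at h
  have hb : b ∈ π := (stackSort_perm π).mem_iff.mp (by simp [h])
  rw [stackSort_of_ne_nil hne, show τ ++ [b, a] = τ ++ [b] ++ [a] by simp] at h
  have h1 := (List.append_inj' h rfl).2
  have h2 := List.le_max_of_mem hb
  simp only [List.cons.injEq, and_true] at h1
  omega

theorem stackSortPreimage_append_singleton {τ : List ℕ} {m : ℕ} (hm : ∀ x ∈ τ, x < m)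
    (hτ : IsPermutation (τ ++ [m])) :
    stackSortPreimage {τ ++ [m]} = ⋃ i ∈ (Finset.range (τ.length + 1) : Set ℕ),
      (fun p : List ℕ × List ℕ => p.1 ++ m :: p.2) ''
        (stackSortPreimage {τ.take i} ×ˢ stackSortPreimage {τ.drop i}) := by
  ext π
  simp only [Set.mem_iUnion, Set.mem_image, Set.mem_prod, Prod.exists, exists_prop]
  constructor
  · rintro ⟨hπ, h⟩
    rw [Set.mem_singleton_iff] at h
    have hne : π ≠ [] := by
      rintro rfl
      rw [stackSort_nil] at h
      simp at h
    rw [stackSort_of_ne_nil hne] at h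
    obtain ⟨h1, h2⟩ := List.append_inj' h rfl
    simp only [List.cons.injEq, and_true] at h2
    rw [h2] at h1
    have hmem : m ∈ π := h2 ▸ List.max_mem hne
    set L := leftOf m π with hL
    set R := rightOf m π with hR
    have hπ' : L ++ m :: R = π := leftOf_append_rightOf hmem
    have hlen := (stackSort_perm L).length_eq
    refine ⟨L.length, ?_, L, R, ⟨⟨⟨?_, ?_⟩, ?_⟩, ⟨?_, ?_⟩, ?_⟩, hπ'⟩
    · rw [← h1]
      simp [hlen]
    · exact hπ.1.sublist (hπ' ▸ List.sublist_append_left _ _)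
    · exact fun x hx => hπ.2 x (hπ' ▸ by simp [hx])
    · rw [Set.mem_singleton_iff, ← h1, ← hlen, List.take_left]
    · exact hπ.1.sublist
        (hπ' ▸ (List.sublist_cons_self _ _).trans (List.sublist_append_right _ _))
    · exact fun x hx => hπ.2 x (hπ' ▸ by simp [hx])
    · rw [Set.mem_singleton_iff, ← h1, ← hlen, List.drop_left]
  · rintro ⟨i, _, L, R, ⟨⟨_, h1⟩, ⟨_, h2⟩⟩, rfl⟩
    rw [Set.mem_singleton_iff] at h1 h2
    have hL : ∀ x ∈ L, x < m := fun x hx =>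
      hm x (List.mem_of_mem_take (h1 ▸ (stackSort_perm L).mem_iff.mpr hx))
    have hR : ∀ x ∈ R, x < m := fun x hx =>
      hm x (List.mem_of_mem_drop (h2 ▸ (stackSort_perm R).mem_iff.mpr hx))
    have h : stackSort (L ++ m :: R) = τ ++ [m] := by
      rw [stackSort_append_cons hL hR, h1, h2, List.take_append_drop]
    have hp := stackSort_perm (L ++ m :: R)
    rw [h] at hp
    exact ⟨⟨hp.nodup_iff.mp hτ.1, fun x hx => hτ.2 x (hp.mem_iff.mpr hx)⟩, h⟩

theorem ncard_stackSortPreimage_append_singleton {τ : List ℕ} {m : ℕ} (hm : ∀ x ∈ τ, x < m)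
    (hτ : IsPermutation (τ ++ [m])) :
    (stackSortPreimage {τ ++ [m]}).ncard = ∑ i ∈ Finset.range (τ.length + 1),
      (stackSortPreimage {τ.take i}).ncard * (stackSortPreimage {τ.drop i}).ncard := by
  have hlt : ∀ {i : ℕ} {L : List ℕ}, L ∈ stackSortPreimage {τ.take i} → m ∉ L := by
    rintro i L ⟨_, h⟩ hL
    rw [Set.mem_singleton_iff] at h
    exact lt_irrefl m (hm m (List.mem_of_mem_take (h ▸ (stackSort_perm L).mem_iff.mpr hL)))
  have hinj : ∀ {L R L' R' : List ℕ}, m ∉ L → m ∉ L' → L ++ m :: R = L' ++ m :: R' →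
      L = L' ∧ R = R' := by
    intro L R L' R' h h' heq
    constructor
    · rw [← leftOf_append_cons (R := R) h, heq, leftOf_append_cons h']
    · rw [← rightOf_append_cons (R := R) h, heq, rightOf_append_cons h']
  rw [stackSortPreimage_append_singleton hm hτ,
    (Finset.finite_toSet _).ncard_biUnion, finsum_mem_coe_finset]
  · apply Finset.sum_congr rfl
    intro i _
    rw [Set.InjOn.ncard_image, Set.ncard_prod]
    rintro ⟨L, R⟩ ⟨hL, _⟩ ⟨L', R'⟩ ⟨hL', _⟩ heq
    obtain ⟨h1, h2⟩ := hinj (hlt hL) (hlt hL') heq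
    exact Prod.ext h1 h2
  · intro i _
    exact ((finite_stackSortPreimage_singleton _).prod
      (finite_stackSortPreimage_singleton _)).image _
  -- The cut is recovered from the preimage: `i` is the length of the part before `m`.
  · intro i hi j hj hij
    rw [Function.onFun, Set.disjoint_left]
    rintro _ ⟨⟨L, R⟩, ⟨hL, _⟩, rfl⟩ ⟨⟨L', R'⟩, ⟨hL', _⟩, heq⟩
    obtain ⟨h1, -⟩ := hinj (hlt hL') (hlt hL) heq
    have e1 := (stackSort_perm L).length_eq
    have e2 := (stackSort_perm L').length_eq
    rw [Set.mem_singleton_iff.mp hL.2, List.length_take] at e1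
    rw [Set.mem_singleton_iff.mp hL'.2, List.length_take] at e2
    simp only [Finset.coe_range, Set.mem_Iio] at hi hj
    have e3 := congrArg List.length h1
    dsimp only at e1 e2 e3
    omega

/-- `IsLayered w l σ`: the entries of `σ` exceed `l`, and `σ` is a direct sum of layers of size 1
(letters `false` of `w`) and decreasing layers of size 2 (letters `true`). -/
inductive IsLayered : List Bool → ℕ → List ℕ → Prop
  | nil (l : ℕ) : IsLayered [] l []
  | single {w : List Bool} {l a : ℕ} {τ : List ℕ} (h : l < a) (hτ : IsLayered w a τ) :
      IsLayered (false :: w) l (a :: τ)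
  | double {w : List Bool} {l a b : ℕ} {τ : List ℕ} (h : l < a) (hab : a < b)
      (hτ : IsLayered w b τ) : IsLayered (true :: w) l (b :: a :: τ)

theorem IsLayered.mono {w : List Bool} {l l' : ℕ} {σ : List ℕ} (h : IsLayered w l σ)
    (hl : l' ≤ l) : IsLayered w l' σ := by
  cases h with
  | nil => exact .nil _
  | single h hτ => exact .single (by omega) hτ
  | double h hab hτ => exact .double (by omega) hab hτ

theorem IsLayered.lt {w : List Bool} {l : ℕ} {σ : List ℕ} (h : IsLayered w l σ) :
    ∀ x ∈ σ, l < x := by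
  induction h with
  | nil => simp
  | single h _ ih =>
    intro x hx
    rcases List.mem_cons.mp hx with rfl | hx
    · exact h
    · exact h.trans (ih x hx)
  | double h hab _ ih =>
    intro x hx
    rcases List.mem_cons.mp hx with rfl | hx
    · omega
    rcases List.mem_cons.mp hx with rfl | hx
    · exact h
    · exact (h.trans hab).trans (ih x hx)

theorem IsLayered.nodup {w : List Bool} {l : ℕ} {σ : List ℕ} (h : IsLayered w l σ) :
    σ.Nodup := by
  induction h with
  | nil => simp
  | single h hτ ih =>
    exact List.nodup_cons.mpr ⟨fun hx => lt_irrefl _ (hτ.lt _ hx), ih⟩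
  | double h hab hτ ih =>
    refine List.nodup_cons.mpr ⟨fun hx => ?_, List.nodup_cons.mpr ⟨fun hx => ?_, ih⟩⟩
    · rcases List.mem_cons.mp hx with rfl | hx
      · exact lt_irrefl _ hab
      · exact lt_irrefl _ (hτ.lt _ hx)
    · exact lt_asymm hab (hτ.lt _ hx)

theorem IsLayered.isPermutation {w : List Bool} {l : ℕ} {σ : List ℕ} (h : IsLayered w l σ) :
    IsPermutation σ :=
  ⟨h.nodup, fun x hx => (Nat.zero_le l).trans_lt (h.lt x hx)⟩

theorem IsLayered.exists_of_append_false {w : List Bool} {l : ℕ} {σ : List ℕ}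
    (h : IsLayered (w ++ [false]) l σ) :
    ∃ τ m, σ = τ ++ [m] ∧ IsLayered w l τ ∧ ∀ x ∈ τ, x < m := by
  induction w generalizing l σ with
  | nil =>
    cases h with
    | single h hτ =>
      cases hτ
      exact ⟨[], _, rfl, .nil _, by simp⟩
  | cons c w ih =>
    cases h with
    | single h hτ =>
      obtain ⟨τ, m, rfl, h1, h2⟩ := ih hτ
      refine ⟨_ :: τ, m, rfl, .single h h1, ?_⟩
      intro x hx
      rcases List.mem_cons.mp hx with rfl | hx
      · exact hτ.lt m (by simp)
      · exact h2 x hx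
    | double h hab hτ =>
      obtain ⟨τ, m, rfl, h1, h2⟩ := ih hτ
      refine ⟨_ :: _ :: τ, m, rfl, .double h hab h1, ?_⟩
      have hm := hτ.lt m (by simp)
      intro x hx
      rcases List.mem_cons.mp hx with rfl | hx
      · exact hm
      rcases List.mem_cons.mp hx with rfl | hx
      · omega
      · exact h2 x hx

theorem IsLayered.exists_of_append_true {w : List Bool} {l : ℕ} {σ : List ℕ}
    (h : IsLayered (w ++ [true]) l σ) : ∃ τ a b, σ = τ ++ [b, a] ∧ a < b := by
  induction w generalizing l σ with
  | nil =>
    cases h with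
    | double h hab hτ =>
      cases hτ
      exact ⟨[], _, _, rfl, hab⟩
  | cons c w ih =>
    cases h with
    | single h hτ =>
      obtain ⟨τ, a, b, rfl, h1⟩ := ih hτ
      exact ⟨_ :: τ, a, b, rfl, h1⟩
    | double h hab hτ =>
      obtain ⟨τ, a, b, rfl, h1⟩ := ih hτ
      exact ⟨_ :: _ :: τ, a, b, rfl, h1⟩

/-- Cutting inside a layer `b a` leaves `b` as a last singleton layer of the prefix and `a` as a
first one of the suffix. Such pieces skip values, hence a notion of layered list that allows gaps.
-/
theorem IsLayered.sum_take_mul_drop {w : List Bool} {l : ℕ} {σ : List ℕ} (hσ : IsLayered w l σ)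
    {f h : List ℕ → ℕ} {f' h' : List Bool → ℕ}
    (hf : ∀ u ρ, u.length ≤ w.length → IsLayered u l ρ → f ρ = f' u)
    (hh : ∀ u l' ρ, u.length ≤ w.length → IsLayered u l' ρ → h ρ = h' u) :
    ∑ i ∈ Finset.range (σ.length + 1), f (σ.take i) * h (σ.drop i) = splitConv f' h' w := by
  induction hσ generalizing f f' with
  | nil l => simp [splitConv, hf [] [] (by simp) (.nil _), hh [] l [] (by simp) (.nil _)]
  | @single w l a τ hla hτ ih =>
    rw [List.length_cons, Finset.sum_range_succ']
    simp only [List.take_succ_cons, List.drop_succ_cons, List.take_zero, List.drop_zero, splitConv,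
      Bool.false_eq_true, if_false, add_zero]
    rw [hf [] [] (by simp) (.nil _), hh _ l _ le_rfl (.single hla hτ), add_comm]
    congr 1
    exact ih (f := fun ρ => f (a :: ρ)) (f' := fun u => f' (false :: u))
      (fun u ρ hu hρ => hf _ _ (by simpa using hu) (.single hla hρ))
      (fun u l' ρ hu => hh u l' ρ (hu.trans (by simp)))
  | @double w l a b τ hla hab hτ ih =>
    rw [List.length_cons, List.length_cons, Finset.sum_range_succ', Finset.sum_range_succ']
    simp only [List.take_succ_cons, List.drop_succ_cons, List.take_zero, List.drop_zero, splitConv,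
      if_true]
    rw [hf [] [] (by simp) (.nil _), hh _ l _ le_rfl (.double hla hab hτ),
      hf [false] [b] (by simp) (.single (hla.trans hab) (.nil _)),
      hh (false :: w) l (a :: τ) (by simp) (.single hla (hτ.mono hab.le))]
    rw [ih (f := fun ρ => f (b :: a :: ρ)) (f' := fun u => f' (true :: u))
      (fun u ρ hu hρ => hf _ _ (by simpa using hu) (.double hla hab hρ))
      (fun u l' ρ hu => hh u l' ρ (hu.trans (by simp)))]
    ring

theorem IsLayered.ncard_stackSortPreimage {w : List Bool} {l : ℕ} {σ : List ℕ}
    (h : IsLayered w l σ) : (stackSortPreimage {σ}).ncard = fertility w := by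
  induction hn : w.length using Nat.strong_induction_on generalizing w l σ with
  | _ n ih =>
    induction w using List.reverseRecOn with
    | nil =>
      cases h
      rw [stackSortPreimage_nil, Set.ncard_singleton, fertility_nil]
    | append_singleton w c _ =>
      rw [List.length_append, List.length_singleton] at hn
      cases c with
      | false =>
        have hσ := h.isPermutation
        obtain ⟨τ, m, rfl, h1, h2⟩ := h.exists_of_append_false
        rw [ncard_stackSortPreimage_append_singleton h2 hσ, fertility_append_false]
        exact h1.sum_take_mul_drop (f := fun ρ => (stackSortPreimage {ρ}).ncard)
          (h := fun ρ => (stackSortPreimage {ρ}).ncard)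
          (fun u ρ hu hρ => ih u.length (by omega) hρ rfl)
          (fun u l' ρ hu hρ => ih u.length (by omega) hρ rfl)
      | true =>
        obtain ⟨τ, a, b, rfl, h1⟩ := h.exists_of_append_true
        rw [stackSortPreimage_eq_empty h1, Set.ncard_empty, fertility_append_true]

end StackSort

/-! ### The pattern-avoiding permutations as layered permutations. -/

section Layered

/-- The layered permutation of `{l + 1, l + 2, …}` with layers coded by the word. -/
def layeredPerm : ℕ → List Bool → List ℕ
  | _, [] => []
  | l, false :: w => (l + 1) :: layeredPerm (l + 1) w
  | l, true :: w => (l + 2) :: (l + 1) :: layeredPerm (l + 2) w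

theorem isLayered_layeredPerm (l : ℕ) (w : List Bool) : IsLayered w l (layeredPerm l w) := by
  induction w generalizing l with
  | nil => exact .nil l
  | cons c w ih =>
    cases c
    · exact .single (by omega) (ih _)
    · exact .double (by omega) (by omega) (ih _)

theorem layeredPerm_injective (l : ℕ) : Function.Injective (layeredPerm l) := by
  intro w w' h
  induction w generalizing l w' with
  | nil => rcases w' with _ | ⟨_ | _, w'⟩ <;> simp [layeredPerm] at h ⊢
  | cons c w ih =>
    rcases w' with _ | ⟨c', w'⟩
    · cases c <;> simp [layeredPerm] at h
    · cases c <;> cases c' <;> simp [layeredPerm] at h <;> rw [ih _ h]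

theorem mem_layeredPerm {l : ℕ} {w : List Bool} {x : ℕ} :
    x ∈ layeredPerm l w ↔ l < x ∧ x ≤ l + w.length + w.count true := by
  induction w generalizing l with
  | nil => simp [layeredPerm]
  | cons c w ih =>
    cases c <;> simp [layeredPerm, ih] <;> omega

theorem des_cons_of_lt {a : ℕ} {σ : List ℕ} (h : ∀ x ∈ σ, a < x) : des (a :: σ) = des σ := by
  cases σ with
  | nil => simp [des]
  | cons b σ =>
    have : ¬ b < a := by have := h b (by simp); omega
    simp [des, this]

theorem des_layeredPerm (l : ℕ) (w : List Bool) : des (layeredPerm l w) = w.count true := by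
  induction w generalizing l with
  | nil => simp [layeredPerm, des]
  | cons c w ih =>
    cases c
    · rw [layeredPerm, des_cons_of_lt fun x hx => (mem_layeredPerm.mp hx).1, ih]
      simp
    · have h : ∀ τ : List ℕ, des ((l + 2) :: (l + 1) :: τ) = des ((l + 1) :: τ) + 1 := by
        intro τ; simp [des]
      rw [layeredPerm, h, des_cons_of_lt fun x hx => by have := (mem_layeredPerm.mp hx).1; omega,
        ih]
      simp

/-- For a permutation, avoiding 231, 312 and 321 means that no entry is followed, with another
entry in between, by a smaller one. -/
theorem avoids_iff {σ : List ℕ} (hσ : σ.Nodup) :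
    (∀ τ ∈ ({[2, 3, 1], [3, 1, 2], [3, 2, 1]} : Set (List ℕ)), ¬ ContainsPattern σ τ) ↔
      ∀ a b c, [a, b, c].Sublist σ → a < c := by
  constructor
  · intro H a b c h
    by_contra hac
    have hnd := hσ.sublist h
    simp only [List.nodup_cons, List.mem_cons, List.not_mem_nil, or_false, not_or] at hnd
    obtain ⟨⟨hab, hac'⟩, hbc, -⟩ := hnd
    have hca : c < a := by omega
    have key : ∀ x y z : ℕ, normalization [a, b, c] = [x, y, z] →
        [x, y, z] ∈ ({[2, 3, 1], [3, 1, 2], [3, 2, 1]} : Set (List ℕ)) → False :=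
      fun x y z hn hm => H _ hm ⟨_, h, hn⟩
    -- Given `c < a`, the position of `b` relative to them selects 231, 312 or 321.
    rcases lt_or_gt_of_ne hab with h1 | h1
    · apply key 2 3 1 _ (by simp)
      simp [normalization, List.countP_cons, h1.le, hca.le, h1.not_ge, hca.not_ge,
        (hca.trans h1).not_ge, (hca.trans h1).le]
    rcases lt_or_gt_of_ne hbc with h2 | h2
    · apply key 3 1 2 _ (by simp)
      simp [normalization, List.countP_cons, h1.le, hca.le, h1.not_ge, hca.not_ge, h2.not_ge, h2.le]
    · apply key 3 2 1 _ (by simp)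
      simp [normalization, List.countP_cons, h1.le, hca.le, h1.not_ge, hca.not_ge, h2.not_ge, h2.le]
  · rintro H τ hτ ⟨ρ, h, rfl⟩
    have hlen : ρ.length = 3 := by
      rw [← List.length_map (f := fun x => ρ.countP (fun y => decide (y ≤ x)))]
      change (normalization ρ).length = 3
      rcases hτ with hτ | hτ | hτ <;> rw [hτ] <;> rfl
    obtain ⟨a, b, c, rfl⟩ := List.length_eq_three.mp hlen
    have hac := H a b c h
    -- Normalization is monotone, whereas each of the three patterns has its first entry above its
    -- last.
    have hle : [a, b, c].countP (fun y => decide (y ≤ a)) ≤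
        [a, b, c].countP (fun y => decide (y ≤ c)) :=
      List.countP_mono_left fun x _ hx => by
        rw [decide_eq_true_eq] at hx ⊢
        omega
    rcases hτ with hτ | hτ | hτ <;>
      (simp only [normalization, List.map_cons, List.map_nil, Set.mem_singleton_iff,
        List.cons.injEq] at hτ; omega)

theorem layeredPerm_sublist_lt {l : ℕ} {w : List Bool} {a b c : ℕ}
    (h : [a, b, c].Sublist (layeredPerm l w)) : a < c := by
  induction w generalizing l with
  | nil => simp [layeredPerm] at h
  | cons d w ih =>
    cases d
    · rw [layeredPerm, List.cons_sublist_cons'] at h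
      rcases h with h | ⟨rfl, h⟩
      · exact ih h
      · exact (mem_layeredPerm.mp (h.subset (by simp))).1
    · rw [layeredPerm, List.cons_sublist_cons', List.cons_sublist_cons'] at h
      rcases h with (h | ⟨rfl, h⟩) | ⟨rfl, h⟩
      · exact ih h
      · have := (mem_layeredPerm.mp (h.subset (show c ∈ [b, c] by simp))).1
        omega
      · rw [List.cons_sublist_cons'] at h
        rcases h with h | ⟨-, h⟩
        · exact (mem_layeredPerm.mp (h.subset (by simp))).1
        · exact (mem_layeredPerm.mp (h.subset (by simp))).1

/-- At most one entry precedes the minimum `l + 1`. If one does, it is `l + 2`; otherwise it would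
precede `l + 1` and then the smaller `l + 2`. Peel off this layer and repeat. -/
theorem exists_eq_layeredPerm {σ : List ℕ} {l n : ℕ} (hσ : σ.Nodup)
    (hmem : ∀ x, x ∈ σ ↔ l < x ∧ x ≤ n) (H : ∀ a b c, [a, b, c].Sublist σ → a < c) :
    ∃ w, σ = layeredPerm l w := by
  induction hk : σ.length using Nat.strong_induction_on generalizing σ l with
  | _ k ih =>
    rcases σ with _ | ⟨a, τ⟩
    · exact ⟨[], rfl⟩
    have hnd := List.nodup_cons.mp hσ
    have ha := (hmem a).mp (by simp)
    by_cases ha1 : a = l + 1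
    · subst ha1
      obtain ⟨w, hw⟩ := ih τ.length (by simp [← hk]) (σ := τ) (l := l + 1) hnd.2
        (fun x => by
          have h1 := hmem x
          rw [List.mem_cons] at h1
          constructor
          · intro hx
            have h2 := h1.mp (Or.inr hx)
            have h3 : x ≠ l + 1 := fun h => hnd.1 (h ▸ hx)
            omega
          · intro hx
            have h2 := h1.mpr (by omega)
            exact h2.resolve_left (by omega))
        (fun x y z h => H x y z (h.cons _)) rfl
      exact ⟨false :: w, by rw [layeredPerm, hw]⟩
    · have hl1 : l + 1 ∈ τ :=
        (List.mem_cons.mp ((hmem (l + 1)).mpr (by omega))).resolve_left (by omega)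
      rcases τ with _ | ⟨b, τ⟩
      · simp at hl1
      have hb : b = l + 1 := by
        by_contra hb
        have h1 : l + 1 ∈ τ := (List.mem_cons.mp hl1).resolve_left (by omega)
        have := H a b (l + 1)
          ((List.Sublist.cons_cons _ (List.Sublist.cons_cons _ (List.singleton_sublist.mpr h1))))
        omega
      subst hb
      have ha2 : a = l + 2 := by
        by_contra ha2
        have h0 : l + 2 ∈ a :: (l + 1) :: τ := (hmem (l + 2)).mpr (by omega)
        have h1 : l + 2 ∈ τ :=
          (List.mem_cons.mp ((List.mem_cons.mp h0).resolve_left (by omega))).resolve_left (by omega)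
        have := H a (l + 1) (l + 2)
          ((List.Sublist.cons_cons _ (List.Sublist.cons_cons _ (List.singleton_sublist.mpr h1))))
        omega
      subst ha2
      have hnd' := List.nodup_cons.mp hnd.2
      obtain ⟨w, hw⟩ := ih τ.length (by simp [← hk]) (σ := τ) (l := l + 2) hnd'.2
        (fun x => by
          have h1 := hmem x
          rw [List.mem_cons, List.mem_cons] at h1
          constructor
          · intro hx
            have h2 := h1.mp (Or.inr (Or.inr hx))
            have h3 : x ≠ l + 1 := fun h => hnd'.1 (h ▸ hx)
            have h4 : x ≠ l + 2 := fun h => hnd.1 (h ▸ List.mem_cons_of_mem _ hx)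
            omega
          · intro hx
            have h2 := h1.mpr (by omega)
            exact (h2.resolve_left (by omega)).resolve_left (by omega))
        (fun x y z h => H x y z ((h.cons _).cons _)) rfl
      exact ⟨true :: w, by rw [layeredPerm, hw]⟩

theorem AvDes_eq_image (n k : ℕ) :
    AvDes n k {[2, 3, 1], [3, 1, 2], [3, 2, 1]} =
      layeredPerm 0 '' ((wordsOfLength (n - k)).filter fun w => w.count true = k) := by
  have hmem : ∀ {σ : List ℕ}, σ.toFinset = Finset.Icc 1 n ↔ ∀ x, x ∈ σ ↔ 0 < x ∧ x ≤ n := by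
    intro σ
    rw [Finset.ext_iff]
    simp [Nat.succ_le_iff]
  ext σ
  simp only [AvDes, Av, S, Set.mem_ofPred_eq, Set.mem_image, Finset.coe_filter, mem_wordsOfLength]
  constructor
  · rintro ⟨⟨⟨⟨hnd, hpos⟩, hS⟩, hav⟩, hdes⟩
    rw [avoids_iff hnd] at hav
    rw [hmem] at hS
    obtain ⟨w, rfl⟩ := exists_eq_layeredPerm hnd hS hav
    rw [des_layeredPerm] at hdes
    refine ⟨w, ⟨?_, hdes⟩, rfl⟩
    -- Comparing the largest values of the two descriptions gives `n = w.length + w.count true`.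
    have h1 := hS n
    have h2 := hS (w.length + w.count true)
    rw [mem_layeredPerm] at h1 h2
    have := List.count_le_length (a := true) (l := w)
    omega
  · rintro ⟨w, ⟨hlen, hcount⟩, rfl⟩
    have hnd := (isLayered_layeredPerm 0 w).nodup
    refine ⟨⟨⟨(isLayered_layeredPerm 0 w).isPermutation, ?_⟩, ?_⟩, ?_⟩
    · rw [hmem]
      intro x
      rw [mem_layeredPerm]
      have := List.count_le_length (a := true) (l := w)
      omega
    · rw [avoids_iff hnd]
      exact fun a b c h => layeredPerm_sublist_lt h
    · rw [des_layeredPerm, hcount]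

theorem stackSortPreimage_AvDes (n k : ℕ) :
    stackSortPreimage (AvDes n k {[2, 3, 1], [3, 1, 2], [3, 2, 1]}) =
      ⋃ w ∈ ((wordsOfLength (n - k)).filter (fun w => w.count true = k) : Set (List Bool)),
        stackSortPreimage {layeredPerm 0 w} := by
  rw [AvDes_eq_image]
  ext π
  simp only [stackSortPreimage, Set.mem_image, Set.mem_ofPred_eq, Set.mem_iUnion,
    Set.mem_singleton_iff, exists_prop]
  constructor
  · rintro ⟨h, w, hw, he⟩
    exact ⟨w, hw, h, he.symm⟩
  · rintro ⟨w, hw, h, he⟩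
    exact ⟨h, w, hw, he.symm⟩

theorem finite_stackSortPreimage_AvDes (n k : ℕ) :
    (stackSortPreimage (AvDes n k {[2, 3, 1], [3, 1, 2], [3, 2, 1]})).Finite := by
  rw [stackSortPreimage_AvDes]
  exact (Finset.finite_toSet _).biUnion fun w _ => finite_stackSortPreimage_singleton _

theorem ncard_stackSortPreimage_AvDes (n k : ℕ) :
    (stackSortPreimage (AvDes n k {[2, 3, 1], [3, 1, 2], [3, 2, 1]})).ncard =
      ∑ w ∈ (wordsOfLength (n - k)).filter (fun w => w.count true = k), fertility w := by
  rw [stackSortPreimage_AvDes, (Finset.finite_toSet _).ncard_biUnion, finsum_mem_coe_finset]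
  · exact Finset.sum_congr rfl fun w _ => (isLayered_layeredPerm 0 w).ncard_stackSortPreimage
  · exact fun w _ => finite_stackSortPreimage_singleton _
  · intro w _ w' _ hne
    rw [Function.onFun, Set.disjoint_left]
    rintro π ⟨_, h⟩ ⟨_, h'⟩
    rw [Set.mem_singleton_iff] at h h'
    exact hne (layeredPerm_injective 0 (h.symm.trans h'))

end Layered

/-! ### The closed form and the conclusion. -/

theorem coeff_fertilitySeries_sub_one (n k : ℕ) (hn : 1 ≤ n) :
    (PowerSeries.coeff (n - k) (fertilitySeries - 1)).coeff k =
      1 / ((n : ℚ) + 1) * ((n - k - 1).choose k : ℚ) * ((2 * n - 2 * k).choose n : ℚ) := by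
  rcases Nat.lt_or_ge k n with hk | hk
  · obtain ⟨m, rfl⟩ : ∃ m, n = m + 1 + k := ⟨n - k - 1, by omega⟩
    have h := coeff_coeff_of_eq_X_mul _ fertilitySeries_sub_one m k
    rw [show m + 1 + k - k = m + 1 by omega, Nat.add_sub_cancel,
      show 2 * (m + 1 + k) - 2 * k = 2 * (m + 1) by omega]
    set c := (PowerSeries.coeff (m + 1) (fertilitySeries - 1)).coeff k
    have hm : (m : ℚ) + 1 ≠ 0 := by positivity
    have hn0 : (((m + 1 + k : ℕ) : ℚ) + 1) ≠ 0 := by positivity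
    split_ifs at h with hkm
    -- Each binomial coefficient is shifted by one; the factor `m + 1 - k` occurs in both shifts and
    -- cancels.
    · have h1 := Nat.choose_mul_succ_eq m k
      have h2 := Nat.choose_succ_right_eq (2 * (m + 1)) (m + 1 + k)
      rw [show 2 * (m + 1) - (m + 1 + k) = m + 1 - k by omega,
        ← Nat.choose_symm_of_eq_add (show 2 * (m + 1) = (m - k) + (m + 1 + k + 1) by omega)] at h2
      have h1' : (m.choose k : ℚ) * (m + 1) = (m + 1).choose k * ((m + 1 - k : ℕ) : ℚ) := by
        exact_mod_cast h1
      have h2' : ((2 * (m + 1)).choose (m - k) : ℚ) * (((m + 1 + k : ℕ) : ℚ) + 1) =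
          (2 * (m + 1)).choose (m + 1 + k) * ((m + 1 - k : ℕ) : ℚ) := by
        exact_mod_cast h2
      have h3 : c * (((m + 1 + k : ℕ) : ℚ) + 1) =
          m.choose k * (2 * (m + 1)).choose (m + 1 + k) := by
        apply mul_left_cancel₀ hm
        linear_combination (((m + 1 + k : ℕ) : ℚ) + 1) * h + ((m + 1).choose k : ℚ) * h2' -
          ((2 * (m + 1)).choose (m + 1 + k) : ℚ) * h1'
      rw [mul_assoc, ← h3]
      field_simp
    · rw [Nat.choose_eq_zero_of_lt (show m < k by omega)]
      simpa [hm] using h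
  · rw [show n - k = 0 by omega, Nat.choose_eq_zero_of_lt (show 0 - 1 < k by omega),
      fertilitySeries_sub_one]
    simp

theorem theorem5p1 (n k : ℕ) (hn : 1 ≤ n) :
    (stackSortPreimage (AvDes n k {[2, 3, 1], [3, 1, 2], [3, 2, 1]})).Finite ∧
    (((stackSortPreimage (AvDes n k {[2, 3, 1], [3, 1, 2], [3, 2, 1]})).ncard : ℕ) : ℚ) =
      1 / ((n : ℚ) + 1) * ((n - k - 1).choose k : ℚ) * ((2 * n - 2 * k).choose n : ℚ) ∧
    ((∑ q ∈ Comp (k + 1) (n - k), compC q * compD q : ℕ) : ℚ) =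
      1 / ((n : ℚ) + 1) * ((n - k - 1).choose k : ℚ) * ((2 * n - 2 * k).choose n : ℚ) := by
  rw [← coeff_fertilitySeries_sub_one n k hn]
  refine ⟨finite_stackSortPreimage_AvDes n k, ?_,
    sum_Comp_eq_coeff _ fertilitySeries_sub_one k (n - k)⟩
  rw [ncard_stackSortPreimage_AvDes, Nat.cast_sum, ← coeff_fertilitySeries, map_sub,
    Polynomial.coeff_sub, PowerSeries.coeff_one]
  -- Removing the empty word matters only at `s^0`; if `n - k = 0` then `k ≥ n ≥ 1`.
  split_ifs with h
  · rw [Polynomial.coeff_one, if_neg (by omega), sub_zero]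
  · simp
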